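/- Let $(X,d)$ be a complete separable metric space and let $\mathfrak m$ be a locally finite non-negative Borel measure on $X$ with full support. (Such a measure is automatically Radon.) Let $\mathcal P_2(X)$ be the set of Borel probability measures on $X$ with finite second moment, with the Wasserstein distance $W_2$. For $\mu\in\mathcal P_2(X)$ let $\mathrm{Ent}_{\mathfrak m}(\mu)=\int\rho\ln\rho\,d\mathfrak m\in[-\infty,+\infty]$ if $\mu=\rho\,\mathfrak m$ (with value $+\infty$ if the positive part of $\rho\ln\rho$ is not integrable), and $\mathrm{Ent}_{\mathfrak m}(\mu)=+\infty$ if $\mu$ is not absolutely continuous with respect to $\mathfrak m$. Assume that $(X,d,\mathfrak m)$ satisfies the $\mathrm{CD}(0,\infty)$ condition: for any $\mu_0,\mu_1\in\mathcal P_2(X)$ there is a constant speed geodesic $(\mu_t)_{t\in[0,1]}$ of $(\mathcal P_2(X),W_2)$ from $\mu_0$ to $\mu_1$ such that $$\mathrm{Ent}_{\mathfrak m}(\mu_t)\le t\,\mathrm{Ent}_{\mathfrak m}(\mu_1)+(1-t)\,\mathrm{Ent}_{\mathfrak m}(\mu_0)\qquad\text{for all }t\in[0,1].$$ Assume also that $(X,d,\mathfrak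 m)$ admits the volume entropy $h\in[0,+\infty]$, i.e. that for some $x_0\in X$, with $B_r(x_0)=\{x: d(x,x_0)<r\}$, $$h=\lim_{r\to+\infty}\frac{\ln \mathfrak m(B_r(x_0))}{r}.$$ Then for every Borel set $\Omega\subset X$ with $\mathfrak m(\Omega)<+\infty$, $$\mathfrak m^+(\Omega)\ \ge\ h\,\mathfrak m(\Omega)\qquad(\text{with } \infty\cdot 0=0),$$ where $\mathfrak m^+(\Omega)=\liminf_{\epsilon\to0^+}\frac{\mathfrak m(\Omega^\epsilon)-\mathfrak m(\Omega)}{\epsilon}$ is the Minkowski content and $\Omega^\epsilon=\{x\in X: d(x,\Omega)<\epsilon\}$. -/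

import Mathlib

open MeasureTheory Filter Topology Set
open scoped ENNReal

noncomputable section

namespace MMS

variable {X : Type*} [MetricSpace X] [MeasurableSpace X]

/-- Couplings (transport plans) of two Borel measures. -/
def IsCoupling (π : Measure (X × X)) (μ ν : Measure X) : Prop :=
  π.map Prod.fst = μ ∧ π.map Prod.snd = ν

/-- The Wasserstein distance of order two, with values in `[0, ∞]`:
the square root of the infimum of `∫ d(x, y)² dπ(x, y)` over all couplings `π`. -/
def W2 (μ ν : Measure X) : ℝ≥0∞ :=
  (⨅ (π : Measure (X × X)) (_ : IsCoupling π μ ν), ∫⁻ z, edist z.1 z.2 ^ 2 ∂π) ^ (1 / 2 : ℝ)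

/-- Membership in `𝒫₂(X)`: Borel probability measures with finite second moment. -/
def IsP2 (μ : Measure X) : Prop :=
  IsProbabilityMeasure μ ∧ ∃ x₀ : X, ∫⁻ x, edist x x₀ ^ 2 ∂μ < ∞

/-- `(μ t)`, `t ∈ [0, 1]`, is a (constant speed, minimizing) geodesic of `(𝒫₂(X), W₂)`.
The values of `μ` outside `[0, 1]` are irrelevant. -/
def IsW2Geodesic (μ : ℝ → Measure X) : Prop :=
  (∀ t ∈ Icc (0 : ℝ) 1, IsP2 (μ t)) ∧
    ∀ s ∈ Icc (0 : ℝ) 1, ∀ t ∈ Icc (0 : ℝ) 1,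
      W2 (μ s) (μ t) = ENNReal.ofReal |t - s| * W2 (μ 0) (μ 1)

open scoped Classical in
/-- The relative entropy `Ent_m(μ) = ∫ ρ ln ρ dm ∈ [-∞, ∞]` if `μ = ρ m`, and `+∞` if `μ` is not
absolutely continuous. The integral is that of the positive part minus that of the negative part,
and it is `+∞` whenever the integral of the positive part is infinite. -/
def relEntropy (m μ : Measure X) : EReal :=
  let f : X → ℝ := fun x => (μ.rnDeriv m x).toReal * Real.log (μ.rnDeriv m x).toReal
  if μ ≪ m ∧ ∫⁻ x, ENNReal.ofReal (f x) ∂m ≠ ∞ then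
    ((∫⁻ x, ENNReal.ofReal (f x) ∂m : ℝ≥0∞) : EReal) -
      ((∫⁻ x, ENNReal.ofReal (-f x) ∂m : ℝ≥0∞) : EReal)
  else ⊤

/-- Non-negative Ricci curvature in the sense of Lott, Sturm and Villani, `CD(0, ∞)`:
the entropy is convex along some Wasserstein geodesic between any two elements of `𝒫₂(X)`. -/
def IsCDZeroInfty (m : Measure X) : Prop :=
  ∀ μ₀ μ₁ : Measure X, IsP2 μ₀ → IsP2 μ₁ →
    ∃ μ : ℝ → Measure X, IsW2Geodesic μ ∧ μ 0 = μ₀ ∧ μ 1 = μ₁ ∧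
      ∀ t ∈ Icc (0 : ℝ) 1,
        relEntropy m (μ t) ≤
          (t : EReal) * relEntropy m μ₁ + ((1 - t : ℝ) : EReal) * relEntropy m μ₀

/-- The space admits the volume entropy `h ∈ [0, ∞]`:
`ln m(B_r(x₀)) / r` tends to `h` as `r → ∞`, for some `x₀`. -/
def HasVolumeEntropy (m : Measure X) (h : ℝ≥0∞) : Prop :=
  ∃ x₀ : X, Tendsto (fun r : ℝ => ENNReal.log (m (Metric.ball x₀ r)) / (r : EReal))
    atTop (𝓝 (h : EReal))

/-- The (lower, outer) Minkowski content of a set of finite measure;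
`Metric.thickening ε Ω` is the open neighbourhood `{x | d(x, Ω) < ε}`. -/
def minkowskiContent (m : Measure X) (Ω : Set X) : ℝ≥0∞ :=
  liminf (fun ε : ℝ => (m (Metric.thickening ε Ω) - m Ω) / ENNReal.ofReal ε) (𝓝[>] 0)

end MMS

end

/-! Transport the uniform distribution on `Ω` to the uniform distribution on a huge ball `B_R`, and
look at a very early time `t` of the geodesic given by `CD(0, ∞)`. If all distances between the two
sets are at most `L` and `t * L < ε`, then `μ t` lives in the `ε`-neighbourhood of `Ω`, so Jensen
gives `-log m(Ω^ε) ≤ Ent(μ t)`. Convexity of the entropy then yields `m(B_R)^t * m(Ω)^(1-t) ≤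
m(Ω^ε)`. For bounded `Ω`, letting `R → ∞` with `t * R → ε` gives `exp(a ε) m(Ω) ≤ m(Ω^ε)` for every
`a < h`; exhaustion by balls removes boundedness, and `1 + a ε ≤ exp(a ε)` concludes.

The concentration of `μ t` needs neither optimal plans nor geodesics in `X`: glued plans give
triples `(y, x, z)`, and mass of `y` far from `Ω` would make the cost exceed what a Wasserstein
geodesic allows. -/

namespace MMS

open ProbabilityTheory

/-! ### Gluing of plans and a pointwise cost inequality -/

/-- The gluing lemma: two measures with the same first marginal are marginals of one measure. -/
theorem exists_gluing {α β γ : Type*} [MeasurableSpace α] [MeasurableSpace β] [MeasurableSpace γ]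
    [StandardBorelSpace α] [Nonempty α] [StandardBorelSpace γ] [Nonempty γ]
    (π₁ : Measure (β × α)) (π₂ : Measure (β × γ)) [IsFiniteMeasure π₁] [IsFiniteMeasure π₂]
    (h : π₁.fst = π₂.fst) :
    ∃ G : Measure (β × α × γ),
      G.map (Prod.map id Prod.fst) = π₁ ∧ G.map (Prod.map id Prod.snd) = π₂ := by
  refine ⟨π₁.fst ⊗ₘ (π₁.condKernel ×ₖ π₂.condKernel), ?_, ?_⟩
  · rw [← Measure.compProd_map measurable_fst, ← Kernel.fst_eq, Kernel.fst_prod,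
      π₁.disintegrate]
  · rw [← Measure.compProd_map measurable_snd, ← Kernel.snd_eq, Kernel.snd_prod, h,
      π₂.disintegrate]

theorem IsCoupling.isFiniteMeasure {X : Type*} [MeasurableSpace X] {π : Measure (X × X)}
    {μ ν : Measure X} [IsFiniteMeasure μ] (h : IsCoupling π μ ν) : IsFiniteMeasure π := by
  refine ⟨?_⟩
  have := measure_lt_top μ univ
  rwa [← h.1, Measure.map_apply measurable_fst .univ, preimage_univ] at this

/-- A quantitative form of the strict convexity of the squared distance on triangles. -/
theorem interpolation_cost_lower_bound {X : Type*} [MetricSpace X] {t ε L : ℝ}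
    (ht : t ∈ Ioo (0 : ℝ) 1) (hL : t * L < ε) {x y z : X} (hxz : dist x z ≤ L)
    (p : Prop) [Decidable p] (hp : p → ε ≤ dist y x) :
    ENNReal.ofReal (t * (1 - t)) * edist x z ^ 2 +
        (if p then ENNReal.ofReal ((ε - t * L) ^ 2) else 0) ≤
      ENNReal.ofReal (1 - t) * edist y x ^ 2 + ENNReal.ofReal t * edist y z ^ 2 := by
  obtain ⟨h0, h1⟩ := ht
  have h1' : 0 ≤ 1 - t := by linarith
  have hif : (if p then ENNReal.ofReal ((ε - t * L) ^ 2) else 0) =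
      ENNReal.ofReal (if p then (ε - t * L) ^ 2 else 0) := by split_ifs <;> simp
  have hpos : (0 : ℝ) ≤ if p then (ε - t * L) ^ 2 else 0 := by split_ifs <;> positivity
  rw [hif, edist_dist, edist_dist, edist_dist, ← ENNReal.ofReal_pow dist_nonneg,
    ← ENNReal.ofReal_pow dist_nonneg, ← ENNReal.ofReal_pow dist_nonneg,
    ← ENNReal.ofReal_mul (by positivity), ← ENNReal.ofReal_mul h1', ← ENNReal.ofReal_mul h0.le,
    ← ENNReal.ofReal_add (by positivity) hpos, ← ENNReal.ofReal_add (by positivity) (by positivity)]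
  apply ENNReal.ofReal_le_ofReal
  have hb : (dist x z - dist y x) ^ 2 ≤ dist y z ^ 2 := by
    apply sq_le_sq'
    · have := dist_triangle y z x
      rw [dist_comm z x] at this
      linarith
    · have := dist_triangle x y z
      rw [dist_comm x y] at this
      linarith
  have hmain : (if p then (ε - t * L) ^ 2 else 0) ≤ (dist y x - t * dist x z) ^ 2 := by
    split_ifs with h
    · have := hp h
      have := mul_le_mul_of_nonneg_left hxz h0.le
      apply pow_le_pow_left₀ <;> linarith
    · positivity
  -- With `u = dist y x` and `D = dist x z`: `(1-t) u² + t (D-u)² = t (1-t) D² + (u - t D)²`.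
  nlinarith [mul_le_mul_of_nonneg_left hb h0.le]

/-! ### Localization of Wasserstein geodesics -/

section Transport

variable {X : Type*} [MetricSpace X] [MeasurableSpace X]

theorem W2_sq (μ ν : Measure X) :
    W2 μ ν ^ 2 = ⨅ (π : Measure (X × X)) (_ : IsCoupling π μ ν), ∫⁻ z, edist z.1 z.2 ^ 2 ∂π := by
  rw [W2, ← ENNReal.rpow_natCast, ← ENNReal.rpow_mul]
  norm_num

theorem W2_sq_le_lintegral {π : Measure (X × X)} {μ ν : Measure X} (h : IsCoupling π μ ν) :
    W2 μ ν ^ 2 ≤ ∫⁻ z, edist z.1 z.2 ^ 2 ∂π := by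
  rw [W2_sq]
  exact iInf₂_le π h

theorem W2_ne_top [TopologicalSpace.SeparableSpace X] {L : ℝ} {Ω A : Set X}
    (hdist : ∀ x ∈ Ω, ∀ y ∈ A, dist x y ≤ L) {μ₀ μ₁ : Measure X} [IsProbabilityMeasure μ₀] [IsProbabilityMeasure μ₁]
    (h₀ : μ₀ Ωᶜ = 0) (h₁ : μ₁ Aᶜ = 0) : W2 μ₀ μ₁ ≠ ∞ := by
  have : SecondCountableTopology X := UniformSpace.secondCountable_of_separable X
  have hc : IsCoupling (μ₀.prod μ₁) μ₀ μ₁ := ⟨by simp, by simp⟩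
  have hle : W2 μ₀ μ₁ ^ 2 ≤ ENNReal.ofReal L ^ 2 := by
    refine (W2_sq_le_lintegral hc).trans ?_
    calc
      _ ≤ ∫⁻ _, ENNReal.ofReal L ^ 2 ∂(μ₀.prod μ₁) := by
        refine lintegral_mono_ae ?_
        have hx : ∀ᵐ z ∂(μ₀.prod μ₁), z.1 ∈ Ω :=
          Measure.quasiMeasurePreserving_fst.ae (p := fun x => x ∈ Ω) h₀
        have hy : ∀ᵐ z ∂(μ₀.prod μ₁), z.2 ∈ A :=
          Measure.quasiMeasurePreserving_snd.ae (p := fun x => x ∈ A) h₁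
        filter_upwards [hx, hy] with z h1 h2
        rw [edist_dist]
        gcongr
        exact hdist _ h1 _ h2
      _ = _ := by simp
  intro h
  rw [h] at hle
  simp at hle

variable [CompleteSpace X] [TopologicalSpace.SeparableSpace X] [BorelSpace X]

/-- Gluing the plans along `ν` puts `x ∈ Ω`, `y` and `z ∈ A` on one space, where the pointwise
inequality integrates; its excess term is charged when `y` is outside the neighbourhood. -/
theorem coupling_cost_lower_bound [Nonempty X] {t ε L : ℝ} (ht : t ∈ Ioo (0 : ℝ) 1)
    (hL : t * L < ε) {Ω A : Set X}
    (hdist : ∀ x ∈ Ω, ∀ y ∈ A, dist x y ≤ L) {μ₀ ν μ₁ : Measure X} [IsFiniteMeasure μ₀]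
    [IsFiniteMeasure ν] (h₀ : μ₀ Ωᶜ = 0) (h₁ : μ₁ Aᶜ = 0) {π₁ π₂ : Measure (X × X)}
    (hπ₁ : IsCoupling π₁ μ₀ ν) (hπ₂ : IsCoupling π₂ ν μ₁) :
    ENNReal.ofReal (t * (1 - t)) * W2 μ₀ μ₁ ^ 2 +
        ENNReal.ofReal ((ε - t * L) ^ 2) * ν (Metric.thickening ε Ω)ᶜ ≤
      ENNReal.ofReal (1 - t) * (∫⁻ z, edist z.1 z.2 ^ 2 ∂π₁) +
        ENNReal.ofReal t * (∫⁻ z, edist z.1 z.2 ^ 2 ∂π₂) := by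
  classical
  have : SecondCountableTopology X := UniformSpace.secondCountable_of_separable X
  have := hπ₁.isFiniteMeasure
  have := hπ₂.isFiniteMeasure
  -- The swap makes `ν` the first marginal of both plans; the coordinates of `G` are `(y, x, z)`.
  obtain ⟨G, hG₁, hG₂⟩ := exists_gluing (π₁.map Prod.swap) π₂ (by
    rw [Measure.fst_map_swap, Measure.fst, Measure.snd, hπ₁.2, hπ₂.1])
  have hG₁' : G.map (fun q => (q.2.1, q.1)) = π₁ := by
    calc
      _ = (G.map (Prod.map id Prod.fst)).map Prod.swap := by
        rw [Measure.map_map measurable_swap (by fun_prop)]; rfl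
      _ = π₁ := by
        rw [hG₁, Measure.map_map measurable_swap measurable_swap, Prod.swap_swap_eq, Measure.map_id]
  have hG₂' : G.map (fun q => (q.1, q.2.2)) = π₂ := hG₂
  have hx : G.map (fun q => q.2.1) = μ₀ := by
    rw [← hπ₁.1, ← hG₁', Measure.map_map measurable_fst (by fun_prop)]; rfl
  have hy : G.map (fun q => q.1) = ν := by
    rw [← hπ₁.2, ← hG₁', Measure.map_map measurable_snd (by fun_prop)]; rfl
  have hz : G.map (fun q => q.2.2) = μ₁ := by
    rw [← hπ₂.2, ← hG₂', Measure.map_map measurable_snd (by fun_prop)]; rfl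
  have hxz : IsCoupling (G.map (fun q => (q.2.1, q.2.2))) μ₀ μ₁ := by
    constructor
    · rw [Measure.map_map measurable_fst (by fun_prop), ← hx]; rfl
    · rw [Measure.map_map measurable_snd (by fun_prop), ← hz]; rfl
  have haeΩ : ∀ᵐ q ∂G, q.2.1 ∈ Ω := by
    refine ae_of_ae_map (p := fun x => x ∈ Ω) (f := fun q : X × X × X => q.2.1) (by fun_prop) ?_
    rw [hx]; exact h₀
  have haeA : ∀ᵐ q ∂G, q.2.2 ∈ A := by
    refine ae_of_ae_map (p := fun x => x ∈ A) (f := fun q : X × X × X => q.2.2) (by fun_prop) ?_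
    rw [hz]; exact h₁
  have hS : MeasurableSet (Metric.thickening ε Ω)ᶜ := Metric.isOpen_thickening.measurableSet.compl
  have hcost : W2 μ₀ μ₁ ^ 2 ≤ ∫⁻ q, edist q.2.1 q.2.2 ^ 2 ∂G := by
    refine (W2_sq_le_lintegral hxz).trans_eq ?_
    rw [lintegral_map (by fun_prop) (by fun_prop)]
  have hν : ν (Metric.thickening ε Ω)ᶜ =
      ∫⁻ q, (Metric.thickening ε Ω)ᶜ.indicator 1 q.1 ∂G := by
    rw [← hy, ← lintegral_indicator_one hS, lintegral_map (measurable_one.indicator hS)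
      (by fun_prop)]
  have hind : Measurable fun q : X × X × X => (Metric.thickening ε Ω)ᶜ.indicator
      (1 : X → ℝ≥0∞) q.1 := (measurable_one.indicator hS).comp measurable_fst
  calc
    _ ≤ ENNReal.ofReal (t * (1 - t)) * (∫⁻ q, edist q.2.1 q.2.2 ^ 2 ∂G) +
          ENNReal.ofReal ((ε - t * L) ^ 2) *
            ∫⁻ q, (Metric.thickening ε Ω)ᶜ.indicator 1 q.1 ∂G := by
      rw [hν]; gcongr
    _ = ∫⁻ q, ENNReal.ofReal (t * (1 - t)) * edist q.2.1 q.2.2 ^ 2 +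
          ENNReal.ofReal ((ε - t * L) ^ 2) * (Metric.thickening ε Ω)ᶜ.indicator 1 q.1 ∂G := by
      rw [lintegral_add_left (by fun_prop), lintegral_const_mul _ (by fun_prop),
        lintegral_const_mul _ hind]
    _ ≤ ∫⁻ q, ENNReal.ofReal (1 - t) * edist q.1 q.2.1 ^ 2 +
          ENNReal.ofReal t * edist q.1 q.2.2 ^ 2 ∂G := by
      refine lintegral_mono_ae ?_
      filter_upwards [haeΩ, haeA] with q hqΩ hqA
      refine le_trans (le_of_eq ?_) (interpolation_cost_lower_bound ht hL (hdist _ hqΩ _ hqA)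
        (q.1 ∈ (Metric.thickening ε Ω)ᶜ) fun h => ?_)
      · simp only [indicator_apply, Pi.one_apply, mul_ite, mul_one, mul_zero]
      · by_contra! hlt
        exact h (Metric.mem_thickening_iff.2 ⟨_, hqΩ, hlt⟩)
    _ = _ := by
      rw [lintegral_add_left (by fun_prop), lintegral_const_mul _ (by fun_prop),
        lintegral_const_mul _ (by fun_prop), ← hG₁', ← hG₂', lintegral_map (by fun_prop)
        (by fun_prop), lintegral_map (by fun_prop) (by fun_prop)]
      simp only [edist_comm]

theorem W2_sq_lower_bound [Nonempty X] {t ε L : ℝ} (ht : t ∈ Ioo (0 : ℝ) 1)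
    (hL : t * L < ε) {Ω A : Set X}
    (hdist : ∀ x ∈ Ω, ∀ y ∈ A, dist x y ≤ L) {μ₀ ν μ₁ : Measure X} [IsFiniteMeasure μ₀]
    [IsFiniteMeasure ν] (h₀ : μ₀ Ωᶜ = 0) (h₁ : μ₁ Aᶜ = 0) :
    ENNReal.ofReal (t * (1 - t)) * W2 μ₀ μ₁ ^ 2 +
        ENNReal.ofReal ((ε - t * L) ^ 2) * ν (Metric.thickening ε Ω)ᶜ ≤
      ENNReal.ofReal (1 - t) * W2 μ₀ ν ^ 2 + ENNReal.ofReal t * W2 ν μ₁ ^ 2 := by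
  have ha : ENNReal.ofReal (1 - t) ≠ 0 := by simpa using ht.2
  have hb : ENNReal.ofReal t ≠ 0 := by simpa using ht.1
  rw [W2_sq μ₀ ν, W2_sq ν μ₁]
  simp_rw [ENNReal.mul_iInf_of_ne ha ENNReal.ofReal_ne_top,
    ENNReal.mul_iInf_of_ne hb ENNReal.ofReal_ne_top, ENNReal.iInf_add, ENNReal.add_iInf]
  exact le_iInf₂ fun π₁ hπ₁ => le_iInf₂ fun π₂ hπ₂ =>
    coupling_cost_lower_bound ht hL hdist h₀ h₁ hπ₁ hπ₂

/-- Interior points of a Wasserstein geodesic are concentrated near the starting set. -/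
theorem IsW2Geodesic.measure_compl_thickening_eq_zero {μ : ℝ → Measure X} (hμ : IsW2Geodesic μ)
    {t ε L : ℝ} (ht : t ∈ Ioo (0 : ℝ) 1) (hL : t * L < ε) {Ω A : Set X}
    (hdist : ∀ x ∈ Ω, ∀ y ∈ A, dist x y ≤ L) (h₀ : μ 0 Ωᶜ = 0)
    (h₁ : μ 1 Aᶜ = 0) : μ t (Metric.thickening ε Ω)ᶜ = 0 := by
  have m0 : (0 : ℝ) ∈ Icc (0 : ℝ) 1 := by simp
  have m1 : (1 : ℝ) ∈ Icc (0 : ℝ) 1 := by simp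
  have mt : t ∈ Icc (0 : ℝ) 1 := Ioo_subset_Icc_self ht
  have := (hμ.1 0 m0).1
  have := (hμ.1 1 m1).1
  have := (hμ.1 t mt).1
  obtain ⟨x₀, -⟩ := (hμ.1 0 m0).2
  have : Nonempty X := ⟨x₀⟩
  have key := W2_sq_lower_bound (ν := μ t) ht hL hdist h₀ h₁
  have hW := W2_ne_top hdist h₀ h₁
  have h1t : 0 ≤ 1 - t := by linarith [ht.2]
  rw [hμ.2 0 m0 t mt, hμ.2 t mt 1 m1, sub_zero, abs_of_pos ht.1, abs_of_nonneg h1t] at key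
  -- Since `(1-t) t² + t (1-t)² = t (1-t)`, a geodesic leaves no room for the excess term;
  -- finiteness of `W2` permits the cancellation.
  have hR : ENNReal.ofReal (1 - t) * (ENNReal.ofReal t * W2 (μ 0) (μ 1)) ^ 2 +
      ENNReal.ofReal t * (ENNReal.ofReal (1 - t) * W2 (μ 0) (μ 1)) ^ 2 =
      ENNReal.ofReal (t * (1 - t)) * W2 (μ 0) (μ 1) ^ 2 + 0 := by
    have h1 : ENNReal.ofReal t + ENNReal.ofReal (1 - t) = 1 := by
      rw [← ENNReal.ofReal_add ht.1.le h1t]; simp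
    rw [ENNReal.ofReal_mul ht.1.le, add_zero]
    calc
      _ = ENNReal.ofReal t * ENNReal.ofReal (1 - t) * W2 (μ 0) (μ 1) ^ 2 *
          (ENNReal.ofReal t + ENNReal.ofReal (1 - t)) := by ring
      _ = _ := by rw [h1, mul_one]
  rw [hR] at key
  have hfin : ENNReal.ofReal (t * (1 - t)) * W2 (μ 0) (μ 1) ^ 2 ≠ ∞ :=
    ENNReal.mul_ne_top ENNReal.ofReal_ne_top (ENNReal.pow_ne_top hW)
  have := (ENNReal.add_le_add_iff_left hfin).1 key
  rw [nonpos_iff_eq_zero, mul_eq_zero] at this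
  refine this.resolve_left ?_
  have : 0 < ε - t * L := by linarith
  simp only [ENNReal.ofReal_eq_zero, not_le]
  positivity

end Transport

/-! ### Entropy bounds -/

section Entropy

variable {X : Type*} [MeasurableSpace X]

theorem relEntropy_eq_integral {m μ : Measure X} (hac : μ ≪ m)
    (hint : Integrable
      (fun x => (μ.rnDeriv m x).toReal * Real.log (μ.rnDeriv m x).toReal) m) :
    relEntropy m μ =
      ((∫ x, (μ.rnDeriv m x).toReal * Real.log (μ.rnDeriv m x).toReal ∂m : ℝ) : EReal) := by
  have hpos := hint.lintegral_lt_top.ne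
  have hneg := hint.neg.lintegral_lt_top.ne
  simp only [Pi.neg_apply] at hneg
  simp only [relEntropy]
  rw [if_pos ⟨hac, hpos⟩, integral_eq_lintegral_pos_part_sub_lintegral_neg_part hint,
    EReal.coe_sub, EReal.coe_ennreal_toReal hpos, EReal.coe_ennreal_toReal hneg]

/-- Tangent line inequality for the convex function `x ↦ x log x`. -/
theorem mul_log_tangent_le {x c : ℝ} (hx : 0 ≤ x) (hc : 0 < c) :
    x * Real.log c + x - c ≤ x * Real.log x := by
  rcases hx.eq_or_lt with rfl | hx
  · simp [hc.le]
  have h := Real.log_le_sub_one_of_pos (div_pos hc hx)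
  rw [Real.log_div hc.ne' hx.ne'] at h
  have h2 := mul_le_mul_of_nonneg_left h hx.le
  have h3 : x * (c / x - 1) = c - x := by field_simp
  linarith

/-- Jensen's inequality for the entropy. -/
theorem neg_log_measure_le_relEntropy {m μ : Measure X} [SigmaFinite m] [IsProbabilityMeasure μ]
    {E : Set X} (hE : MeasurableSet E) (hfin : m E ≠ ∞) (hμE : μ Eᶜ = 0) :
    ((-Real.log (m.real E) : ℝ) : EReal) ≤ relEntropy m μ := by
  set f : X → ℝ := fun x => (μ.rnDeriv m x).toReal * Real.log (μ.rnDeriv m x).toReal with hf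
  by_cases hcond : μ ≪ m ∧ ∫⁻ x, ENNReal.ofReal (f x) ∂m ≠ ∞
  swap
  · simp only [relEntropy]
    rw [if_neg hcond]
    exact le_top
  obtain ⟨hac, hP⟩ := hcond
  have hmE : m E ≠ 0 := fun h => by
    have h1 : μ univ = 0 := by
      rw [← union_compl_self E]
      exact measure_union_null (hac h) hμE
    simp at h1
  have hE0 : 0 < m.real E := ENNReal.toReal_pos hmE hfin
  -- The tangent to `x log x` is taken at the density of the uniform distribution on `E`.
  set c := (m.real E)⁻¹ with hc
  have hc0 : 0 < c := inv_pos.2 hE0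
  have hzero : ∀ᵐ x ∂m, x ∈ Eᶜ → μ.rnDeriv m x = 0 := by
    rw [← ae_restrict_iff' hE.compl]
    have : ∫⁻ x in Eᶜ, μ.rnDeriv m x ∂m = 0 := by rw [Measure.setLIntegral_rnDeriv hac, hμE]
    exact (lintegral_eq_zero_iff (Measure.measurable_rnDeriv μ m)).1 this
  have hρ : Integrable (fun x => (μ.rnDeriv m x).toReal) m := Measure.integrable_toReal_rnDeriv
  have hI : Integrable (E.indicator fun _ => c) m :=
    (integrable_indicator_iff hE).2 (integrableOn_const hfin)
  have hg : Integrable (fun x => (μ.rnDeriv m x).toReal * Real.log c + (μ.rnDeriv m x).toReal -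
      E.indicator (fun _ => c) x) m := ((hρ.mul_const _).add hρ).sub hI
  have hle : ∀ᵐ x ∂m, (μ.rnDeriv m x).toReal * Real.log c + (μ.rnDeriv m x).toReal -
      E.indicator (fun _ => c) x ≤ f x := by
    filter_upwards [hzero] with x hx
    by_cases hxE : x ∈ E
    · simpa only [indicator_of_mem hxE] using mul_log_tangent_le ENNReal.toReal_nonneg hc0
    · simp [hf, hx hxE, hxE]
  have hfmeas : Measurable f := by fun_prop
  have hfint : Integrable f m := by
    refine ⟨hfmeas.aestronglyMeasurable, ?_⟩
    -- The integrable tangent minorant controls the negative part.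
    have hN : ∫⁻ x, ENNReal.ofReal (-f x) ∂m < ∞ := by
      refine lt_of_le_of_lt (lintegral_mono_ae ?_) hg.neg.lintegral_lt_top
      filter_upwards [hle] with x hx
      exact ENNReal.ofReal_le_ofReal (neg_le_neg hx)
    have hsum : ∫⁻ x, ENNReal.ofReal (f x) + ENNReal.ofReal (-f x) ∂m < ∞ := by
      rw [lintegral_add_left (by fun_prop)]
      exact ENNReal.add_lt_top.2 ⟨hP.lt_top, hN⟩
    refine lt_of_le_of_lt (lintegral_mono fun x => ?_) hsum
    rw [Real.enorm_eq_ofReal_abs]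
    rcases abs_choice (f x) with h | h <;> rw [h] <;> simp
  rw [relEntropy_eq_integral hac hfint, EReal.coe_le_coe_iff]
  calc
    _ = ∫ x, ((μ.rnDeriv m x).toReal * Real.log c + (μ.rnDeriv m x).toReal -
        E.indicator (fun _ => c) x) ∂m := by
      have hs : Integrable (fun x => (μ.rnDeriv m x).toReal * Real.log c +
        (μ.rnDeriv m x).toReal) m := (hρ.mul_const _).add hρ
      rw [integral_sub hs hI, integral_add (hρ.mul_const _) hρ,
        integral_mul_const, Measure.integral_toReal_rnDeriv hac, integral_indicator_const _ hE,
        probReal_univ, hc, Real.log_inv, smul_eq_mul, mul_inv_cancel₀ hE0.ne']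
      ring
    _ ≤ _ := integral_mono_ae hg hfint hle

/-- The entropy of a uniform distribution. -/
theorem relEntropy_cond {m : Measure X} [SigmaFinite m] {E : Set X} (hE : MeasurableSet E)
    (h0 : m E ≠ 0) (hfin : m E ≠ ∞) :
    relEntropy m (cond m E) = ((-Real.log (m.real E) : ℝ) : EReal) := by
  have hE0 : 0 < m.real E := ENNReal.toReal_pos h0 hfin
  have hdens : cond m E = m.withDensity (E.indicator fun _ => (m E)⁻¹) := by
    rw [withDensity_indicator hE, withDensity_const]
    rfl
  have hder : (cond m E).rnDeriv m =ᵐ[m] E.indicator fun _ => (m E)⁻¹ := by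
    rw [hdens]
    exact Measure.rnDeriv_withDensity m (measurable_const.indicator hE)
  have hf : (fun x => ((cond m E).rnDeriv m x).toReal *
      Real.log ((cond m E).rnDeriv m x).toReal) =ᵐ[m]
      E.indicator fun _ => (m.real E)⁻¹ * Real.log (m.real E)⁻¹ := by
    filter_upwards [hder] with x hx
    rw [hx]
    by_cases hxE : x ∈ E
    · simp [hxE, Measure.real]
    · simp [hxE]
  have hint : Integrable (E.indicator fun _ => (m.real E)⁻¹ * Real.log (m.real E)⁻¹) m :=
    (integrable_indicator_iff hE).2 (integrableOn_const hfin)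
  rw [relEntropy_eq_integral (hdens ▸ withDensity_absolutelyContinuous _ _)
    (hint.congr hf.symm), integral_congr_ae hf, integral_indicator_const _ hE, smul_eq_mul,
    ← mul_assoc, mul_inv_cancel₀ hE0.ne', one_mul, Real.log_inv]

end Entropy

theorem isP2_cond {X : Type*} [MetricSpace X] [MeasurableSpace X] {m : Measure X} {E : Set X}
    (hE : MeasurableSet E) (h0 : m E ≠ 0) (hfin : m E ≠ ∞) {x₀ : X} {L : ℝ}
    (hL : ∀ x ∈ E, dist x x₀ ≤ L) : IsP2 (cond m E) := by
  have hprob : IsProbabilityMeasure (cond m E) := cond_isProbabilityMeasure_of_finite h0 hfin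
  refine ⟨hprob, x₀, ?_⟩
  calc
    _ ≤ ∫⁻ _, ENNReal.ofReal L ^ 2 ∂(cond m E) := by
      refine lintegral_mono_ae ?_
      filter_upwards [ae_cond_mem hE] with x hx
      rw [edist_dist]
      gcongr
      exact hL x hx
    _ < ∞ := by simp

theorem sigmaFinite_of_separable {X : Type*} [MetricSpace X] [TopologicalSpace.SeparableSpace X]
    [MeasurableSpace X] (m : Measure X) [IsLocallyFiniteMeasure m] : SigmaFinite m := by
  have : SecondCountableTopology X := UniformSpace.secondCountable_of_separable X
  infer_instance

/-! ### Brunn-Minkowski inequality -/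

section BrunnMinkowski

variable {X : Type*} [MetricSpace X] [CompleteSpace X] [TopologicalSpace.SeparableSpace X]
  [MeasurableSpace X] [BorelSpace X] {m : Measure X} [IsLocallyFiniteMeasure m]

/-- A Brunn-Minkowski inequality: the measure of a neighbourhood of `Ω` controls a geometric mean
of the measures of `Ω` and of a set at bounded distance from `Ω`. -/
theorem IsCDZeroInfty.rpow_mul_rpow_le_of_ne_top (hCD : IsCDZeroInfty m) {Ω A : Set X}
    (hΩ : MeasurableSet Ω) (hA : MeasurableSet A) (hΩ0 : m Ω ≠ 0) (hΩfin : m Ω ≠ ∞)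
    (hAfin : m A ≠ ∞) {t ε L : ℝ} (ht : t ∈ Ioo (0 : ℝ) 1) (hL : t * L < ε)
    (hdist : ∀ x ∈ Ω, ∀ y ∈ A, dist x y ≤ L) :
    m A ^ t * m Ω ^ (1 - t) ≤ m (Metric.thickening ε Ω) := by
  have : SigmaFinite m := sigmaFinite_of_separable m
  rcases eq_or_ne (m A) 0 with hA0 | hA0
  · rw [hA0, ENNReal.zero_rpow_of_pos ht.1, zero_mul]
    exact zero_le
  rcases eq_or_ne (m (Metric.thickening ε Ω)) ∞ with hTfin | hTfin
  · rw [hTfin]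
    exact le_top
  obtain ⟨x, hx⟩ := nonempty_of_measure_ne_zero hΩ0
  obtain ⟨y, hy⟩ := nonempty_of_measure_ne_zero hA0
  obtain ⟨μ, hμ, h0, h1, hent⟩ := hCD (cond m Ω) (cond m A)
    (isP2_cond hΩ hΩ0 hΩfin fun x hx => hdist x hx y hy)
    (isP2_cond hA hA0 hAfin fun y hy => dist_comm x y ▸ hdist x hx y hy)
  have mt : t ∈ Icc (0 : ℝ) 1 := Ioo_subset_Icc_self ht
  have hconc : μ t (Metric.thickening ε Ω)ᶜ = 0 :=
    hμ.measure_compl_thickening_eq_zero ht hL hdist (h0 ▸ ae_cond_mem hΩ) (h1 ▸ ae_cond_mem hA)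
  have := (hμ.1 t mt).1
  have key := (neg_log_measure_le_relEntropy Metric.isOpen_thickening.measurableSet hTfin
    hconc).trans (hent t mt)
  rw [relEntropy_cond hΩ hΩ0 hΩfin, relEntropy_cond hA hA0 hAfin, ← EReal.coe_mul,
    ← EReal.coe_mul, ← EReal.coe_add, EReal.coe_le_coe_iff] at key
  have hTpos : m (Metric.thickening ε Ω) ≠ 0 := fun h => by
    have hε : 0 < ε := by
      have := mul_nonneg ht.1.le (dist_nonneg.trans (hdist x hx y hy))
      linarith
    exact hΩ0 (measure_mono_null (Metric.self_subset_thickening hε Ω) h)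
  have a0 : 0 < m.real A := ENNReal.toReal_pos hA0 hAfin
  have b0 : 0 < m.real Ω := ENNReal.toReal_pos hΩ0 hΩfin
  have c0 : 0 < m.real (Metric.thickening ε Ω) := ENNReal.toReal_pos hTpos hTfin
  have hreal : m.real A ^ t * m.real Ω ^ (1 - t) ≤ m.real (Metric.thickening ε Ω) := by
    rw [← Real.log_le_log_iff (by positivity) c0, Real.log_mul (by positivity) (by positivity),
      Real.log_rpow a0, Real.log_rpow b0]
    linarith
  rw [← ofReal_measureReal hAfin, ← ofReal_measureReal hΩfin, ← ofReal_measureReal hTfin,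
    ENNReal.ofReal_rpow_of_pos a0, ENNReal.ofReal_rpow_of_pos b0,
    ← ENNReal.ofReal_mul (by positivity)]
  exact ENNReal.ofReal_le_ofReal hreal

/-- Balls may have infinite measure and then carry no uniform distribution; `A` is approximated from
inside by subsets of finite measure. -/
theorem IsCDZeroInfty.rpow_mul_rpow_le (hCD : IsCDZeroInfty m) {Ω A : Set X}
    (hΩ : MeasurableSet Ω) (hA : MeasurableSet A) (hΩ0 : m Ω ≠ 0) (hΩfin : m Ω ≠ ∞)
    {t ε L : ℝ} (ht : t ∈ Ioo (0 : ℝ) 1) (hL : t * L < ε)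
    (hdist : ∀ x ∈ Ω, ∀ y ∈ A, dist x y ≤ L) :
    m A ^ t * m Ω ^ (1 - t) ≤ m (Metric.thickening ε Ω) := by
  have : SigmaFinite m := sigmaFinite_of_separable m
  refine ENNReal.mul_le_of_forall_lt fun a ha b hb => ?_
  have ha' : a ^ t⁻¹ < m A := by
    rwa [← ENNReal.rpow_lt_rpow_iff ht.1, ENNReal.rpow_inv_rpow ht.1.ne']
  obtain ⟨B, hB, hBA, haB, hBfin⟩ := Measure.exists_subset_measure_lt_top hA ha'
  refine le_trans (mul_le_mul' ?_ hb.le) (hCD.rpow_mul_rpow_le_of_ne_top hΩ hB hΩ0 hΩfin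
    hBfin.ne ht hL fun x hx y hy => hdist x hx y (hBA hy))
  calc
    a = (a ^ t⁻¹) ^ t := (ENNReal.rpow_inv_rpow ht.1.ne' a).symm
    _ ≤ m B ^ t := ENNReal.rpow_le_rpow haB.le ht.1.le

end BrunnMinkowski

/-! ### From volume growth to growth of neighbourhoods -/

section Growth

variable {X : Type*} [MetricSpace X] [CompleteSpace X] [TopologicalSpace.SeparableSpace X]
  [MeasurableSpace X] [BorelSpace X] {m : Measure X} [IsLocallyFiniteMeasure m]

/-- Exponential volume growth forces exponential growth of neighbourhoods of bounded sets. -/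
theorem IsCDZeroInfty.exp_mul_measure_le_of_subset_ball (hCD : IsCDZeroInfty m) {h : EReal}
    {x₀ : X} (hh : Tendsto (fun r : ℝ => ENNReal.log (m (Metric.ball x₀ r)) / (r : EReal))
      atTop (𝓝 h)) {a : ℝ} (ha : (a : EReal) < h) {ε : ℝ} (hε : 0 < ε) {Ω : Set X}
    (hΩ : MeasurableSet Ω) (hΩfin : m Ω ≠ ∞) {k : ℝ} (hk : Ω ⊆ Metric.ball x₀ k) :
    ENNReal.ofReal (Real.exp (a * ε)) * m Ω ≤ m (Metric.thickening ε Ω) := by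
  rcases eq_or_ne (m Ω) 0 with hΩ0 | hΩ0
  · simp [hΩ0]
  have b0 : 0 < m.real Ω := ENNReal.toReal_pos hΩ0 hΩfin
  -- Points of `Ω` and `B_R` are at distance at most `L = R + k`; the extra `1` in `t = ε / (R + k +
  -- 1)` makes `t * L < ε` strict.
  have ht0 : Tendsto (fun R : ℝ => ε / (R + k + 1)) atTop (𝓝 0) :=
    tendsto_const_nhds.div_atTop
      (tendsto_atTop_add_const_right _ _ (tendsto_atTop_add_const_right _ _ tendsto_id))
  have htR : Tendsto (fun R : ℝ => R * (ε / (R + k + 1))) atTop (𝓝 ε) := by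
    have h1 : Tendsto (fun R : ℝ => ε - (k + 1) * (ε / (R + k + 1))) atTop
        (𝓝 (ε - (k + 1) * 0)) := tendsto_const_nhds.sub (ht0.const_mul _)
    rw [mul_zero, sub_zero] at h1
    refine h1.congr' ?_
    filter_upwards [eventually_gt_atTop (-(k + 1))] with R hR
    have : R + k + 1 ≠ 0 := by linarith
    field_simp
    ring
  have hlim : Tendsto (fun R : ℝ => ENNReal.ofReal (Real.exp (a * (R * (ε / (R + k + 1)))) *
      m.real Ω ^ (1 - ε / (R + k + 1)))) atTop
      (𝓝 (ENNReal.ofReal (Real.exp (a * ε) * m.real Ω ^ (1 - 0 : ℝ)))) := by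
    refine ENNReal.tendsto_ofReal (Tendsto.mul ?_ ?_)
    · exact (Real.continuous_exp.tendsto _).comp (htR.const_mul a)
    · exact (Real.continuousAt_const_rpow b0.ne').tendsto.comp (tendsto_const_nhds.sub ht0)
  rw [sub_zero, Real.rpow_one, ENNReal.ofReal_mul (Real.exp_pos _).le,
    ofReal_measureReal hΩfin] at hlim
  refine le_of_tendsto hlim ?_
  filter_upwards [hh.eventually_const_lt ha, eventually_gt_atTop 0,
    eventually_gt_atTop (-k), eventually_gt_atTop (ε - k - 1)] with R hR hR0 hRk hRε
  have hpos : 0 < R + k + 1 := by linarith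
  set t := ε / (R + k + 1) with ht
  have ht01 : t ∈ Ioo (0 : ℝ) 1 :=
    ⟨div_pos hε hpos, (div_lt_one hpos).2 (by linarith)⟩
  have htL : t * (R + k) < ε := by
    rw [ht, div_mul_eq_mul_div, div_lt_iff₀ hpos]
    nlinarith
  have hball : ENNReal.ofReal (Real.exp (a * R)) ≤ m (Metric.ball x₀ R) := by
    rw [EReal.lt_div_iff (by exact_mod_cast hR0) (EReal.coe_ne_top R)] at hR
    rw [← ENNReal.log_le_log_iff, ENNReal.log_ofReal_of_pos (Real.exp_pos _), Real.log_exp,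
      EReal.coe_mul]
    exact hR.le
  refine le_trans ?_ (hCD.rpow_mul_rpow_le hΩ (A := Metric.ball x₀ R) measurableSet_ball hΩ0 hΩfin
    ht01 htL fun x hx y hy => ?_)
  · rw [ENNReal.ofReal_mul (Real.exp_pos _).le, ← ENNReal.ofReal_rpow_of_pos b0,
      ofReal_measureReal hΩfin]
    gcongr
    calc
      _ = ENNReal.ofReal (Real.exp (a * R)) ^ t := by
        rw [ENNReal.ofReal_rpow_of_pos (Real.exp_pos _), ← Real.exp_mul, mul_assoc]
      _ ≤ _ := ENNReal.rpow_le_rpow hball ht01.1.le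
  · have h1 := Metric.mem_ball.1 (hk hx)
    have h2 := Metric.mem_ball.1 hy
    have := dist_triangle_right x y x₀
    linarith

/-- The bounded case has a constant independent of `k`, so it passes to the supremum over `Ω ∩ B_n`.
-/
theorem IsCDZeroInfty.exp_mul_measure_le (hCD : IsCDZeroInfty m) {h : EReal}
    {x₀ : X} (hh : Tendsto (fun r : ℝ => ENNReal.log (m (Metric.ball x₀ r)) / (r : EReal))
      atTop (𝓝 h)) {a : ℝ} (ha : (a : EReal) < h) {ε : ℝ} (hε : 0 < ε) {Ω : Set X}
    (hΩ : MeasurableSet Ω) (hΩfin : m Ω ≠ ∞) :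
    ENNReal.ofReal (Real.exp (a * ε)) * m Ω ≤ m (Metric.thickening ε Ω) := by
  have hmono : Monotone fun n : ℕ => Ω ∩ Metric.ball x₀ n := fun i j hij =>
    inter_subset_inter_right _ (Metric.ball_subset_ball (by exact_mod_cast hij))
  have hU : Ω = ⋃ n : ℕ, Ω ∩ Metric.ball x₀ n := by
    rw [← inter_iUnion, Metric.iUnion_ball_nat, inter_univ]
  have hsup : m Ω = ⨆ n : ℕ, m (Ω ∩ Metric.ball x₀ n) := by
    conv_lhs => rw [hU]
    exact hmono.measure_iUnion
  rw [hsup, ENNReal.mul_iSup]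
  exact iSup_le fun n => (hCD.exp_mul_measure_le_of_subset_ball hh ha hε
    (hΩ.inter measurableSet_ball) (measure_ne_top_of_subset inter_subset_left hΩfin)
    inter_subset_right).trans
    (measure_mono (Metric.thickening_subset_of_subset ε inter_subset_left))

end Growth

end MMS

theorem theorem3p1 {X : Type*} [MetricSpace X] [CompleteSpace X]
    [TopologicalSpace.SeparableSpace X] [MeasurableSpace X] [BorelSpace X]
    (m : Measure X) [IsLocallyFiniteMeasure m] [m.IsOpenPosMeasure]
    (hCD : MMS.IsCDZeroInfty m) (h : ℝ≥0∞) (hh : MMS.HasVolumeEntropy m h)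
    (Ω : Set X) (hΩ : MeasurableSet Ω) (hΩfin : m Ω < ∞) :
    h * m Ω ≤ MMS.minkowskiContent m Ω := by
  obtain ⟨x₀, hx₀⟩ := hh
  -- Working with finite `a < h` also covers `h = ∞`, including `∞ * 0 = 0`.
  refine ENNReal.mul_le_of_forall_lt fun a ha b hb => le_trans (mul_le_mul_right hb.le a) ?_
  lift a to NNReal using ha.ne_top
  have ha' : ((a : ℝ) : EReal) < (h : EReal) := EReal.coe_ennreal_lt_coe_ennreal_iff.2 ha
  refine le_liminf_of_le (by isBoundedDefault) ?_
  filter_upwards [self_mem_nhdsWithin] with ε (hε : 0 < ε)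
  have hε' : ENNReal.ofReal ε ≠ 0 := by simpa using hε
  rw [ENNReal.le_div_iff_mul_le (Or.inl hε') (Or.inl ENNReal.ofReal_ne_top)]
  -- The difference quotient is at least `a * m Ω` for every `ε > 0`, not only in the limit.
  refine ENNReal.le_sub_of_add_le_right hΩfin.ne ?_
  refine le_trans ?_ (hCD.exp_mul_measure_le hx₀ ha' hε hΩ hΩfin.ne)
  calc
    _ = ENNReal.ofReal (a * ε + 1) * m Ω := by
      rw [ENNReal.ofReal_add (by positivity) zero_le_one, ENNReal.ofReal_mul a.coe_nonneg,
        ENNReal.ofReal_coe_nnreal, ENNReal.ofReal_one]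
      ring
    _ ≤ _ := by
      gcongr
      exact Real.add_one_le_exp _
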